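/- All graphs are finite and loopless and may have multiple edges. A circuit is a connected $2$-regular graph (two parallel edges form a circuit of length $2$). A graph is supereulerian if it contains a spanning subgraph that is connected and has all degrees even; it is Hamiltonian if it contains a spanning circuit; it is cubic if every vertex has degree $3$. A signed graph $(G,\sigma)$ is a graph $G$ together with a signature $\sigma : E(G)\to\{\pm1\}$, and it is called supereulerian, Hamiltonian or cubic if $G$ is. An orientation of $(G,\sigma)$ is a map $\tau$ assigning $\pm1$ to every half-edge (incident edge–vertex pair) $(e,v)$ such that $\tau(e,u)\,\tau(e,v)=-\sigma(e)$ for each edge $e$ with ends $u,v$. For a positive integer $k$, a nowhere-zero $k$-flow of $(G,\sigma)$ is a pair $(\tau,f)$ of an orientation $\tau$ and a function $f:E(G)\to\mathbb{Z}$ with $0<|f(e)|<k$ for every edge $e$ and $\sum_{e\ni v}\tau(e,v)f(e)=0$ for every vertex $v$. A signed graph is flow-admissible if it admits a nowhere-zero $m$-flow for some positive integer $m$. **Theorem 3.4.** Let $k$ be a positive integer. Then the following statements are equivalent: 1. Every flow-admissible signed supereulerian graph admits a nowhere-zero $k$-flow. 2. Every flow-admissible signed Hamiltonian graph admits a nowhere-zero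 $k$-flow. 3. Every flow-admissible signed Hamiltonian cubic graph admits a nowhere-zero $k$-flow. -/

import Mathlib

/-! Signed multigraphs and integer flows on them, on top of Mathlib's multigraphs `Graph α β`. -/

open scoped Graph

universe u

namespace Graph

variable {α β : Type*}

/-- The degree of a vertex: the number of incident edges, with loops counted twice. -/
noncomputable def degree (G : Graph α β) (v : α) : ℕ :=
  (G.incidenceSet v).ncard + (G.loopSet v).ncard

/-- A graph is connected if it has a vertex and any two vertices are joined by a walk. -/
def IsConnected (G : Graph α β) : Prop :=
  V(G).Nonempty ∧ ∀ x ∈ V(G), ∀ y ∈ V(G), Relation.ReflTransGen G.Adj x y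

/-- Every vertex has degree `d`. -/
def IsRegular (G : Graph α β) (d : ℕ) : Prop :=
  ∀ v ∈ V(G), G.degree v = d

/-- A circuit is a connected `2`-regular graph (two parallel edges form a circuit of length `2`). -/
def IsCircuit (G : Graph α β) : Prop :=
  G.IsConnected ∧ G.IsRegular 2

/-- A graph is even if every vertex has even degree. -/
def IsEven (G : Graph α β) : Prop :=
  ∀ v ∈ V(G), Even (G.degree v)

/-- A graph is Eulerian if it is connected and even. -/
def IsEulerian (G : Graph α β) : Prop :=
  G.IsConnected ∧ G.IsEven

/-- A graph is supereulerian if it has a spanning Eulerian subgraph. -/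
def IsSupereulerian (G : Graph α β) : Prop :=
  ∃ H : Graph α β, H ≤s G ∧ H.IsEulerian

/-- A graph is Hamiltonian if it has a spanning circuit. -/
def IsHamiltonian (G : Graph α β) : Prop :=
  ∃ H : Graph α β, H ≤s G ∧ H.IsCircuit

/-- A graph is cubic if it is `3`-regular. -/
def IsCubic (G : Graph α β) : Prop :=
  G.IsRegular 3

end Graph

/-- A signed graph: a finite loopless graph, multiple edges allowed, with a sign `1` or `-1` on
each edge. Only the signs of the edges in `E(graph)` play a role. -/
structure SignedGraph (α β : Type*) where
  /-- The underlying graph. -/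
  graph : Graph α β
  finite_vertexSet : V(graph).Finite
  finite_edgeSet : E(graph).Finite
  loopless : graph.Loopless
  /-- The signature. -/
  sign : β → ℤˣ

namespace SignedGraph

variable {α β : Type*}

/-- An orientation gives a direction to each half-edge. As there are no loops, the half-edges are
the incident pairs `(e, v)`; `τ e v = 1` means that the half-edge of `e` at `v` points away from
`v`, and `τ e v = -1` that it points toward `v`. A positive edge has two opposite directions at its
ends, a negative edge two equal ones. -/
def IsOrientation (Γ : SignedGraph α β) (τ : β → α → ℤˣ) : Prop :=
  ∀ e x y, Γ.graph.IsLink e x y → τ e x * τ e y = -Γ.sign e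

/-- The boundary of `f` at `v`: the signed sum of `f` over the half-edges at `v`. -/
noncomputable def boundary (Γ : SignedGraph α β) (τ : β → α → ℤˣ) (f : β → ℤ) (v : α) : ℤ :=
  ∑ᶠ e ∈ Γ.graph.incidenceSet v, ((τ e v : ℤˣ) : ℤ) * f e

/-- The pair `(τ, f)` is an integer `k`-flow: `τ` is an orientation, the boundary of `f` vanishes
at every vertex, and `|f e| < k` on every edge. -/
structure IsFlow (Γ : SignedGraph α β) (k : ℕ) (τ : β → α → ℤˣ) (f : β → ℤ) : Prop where
  isOrientation : Γ.IsOrientation τ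
  boundary_eq_zero : ∀ v ∈ V(Γ.graph), Γ.boundary τ f v = 0
  abs_lt : ∀ e ∈ E(Γ.graph), |f e| < (k : ℤ)

/-- The signed graph admits a nowhere-zero `k`-flow. -/
def AdmitsNowhereZeroFlow (Γ : SignedGraph α β) (k : ℕ) : Prop :=
  ∃ (τ : β → α → ℤˣ) (f : β → ℤ), Γ.IsFlow k τ f ∧ ∀ e ∈ E(Γ.graph), f e ≠ 0

/-- A signed graph is flow-admissible if it admits a nowhere-zero `k`-flow for some `k`. -/
def FlowAdmissible (Γ : SignedGraph α β) : Prop :=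
  ∃ k : ℕ, Γ.AdmitsNowhereZeroFlow k

end SignedGraph

/-! A circuit is connected with all degrees 2, so only 3 → 1 has content. Given a supereulerian
graph, every vertex is replaced by a circuit through its half-edges, all new edges being positive.
The result is cubic. Three facts finish the proof.

The circuits can be chosen so that the expansion is Hamiltonian (`isHamiltonian_expand`):
`exists_cyclic_arrangement` orders all half-edges in one cycle `ρ` that moves inside vertices and
crosses each edge of the spanning Eulerian subgraph once. The first return `N` of `ρ` to each vertex
(`exists_firstReturn`) defines the circuits, and `ρ` itself traces the Hamiltonian circuit.

Flow-admissibility passes to the expansion (`FlowAdmissible.expand`): a multiple of the old flow is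
extended by summing along the circuits. No bound on its values is needed.

A nowhere-zero `k`-flow of the expansion restricts to the old edges with the same `k`, since the new
edges cancel in the sum over each vertex (`AdmitsNowhereZeroFlow.of_expand`). -/

/-! ### Pairings and alternating colourings. -/

/-- Two fixed-point-free involutions admit a common `2`-colouring. -/
lemma exists_set_alternating {T : Type*} {a b : T → T} (ha : Function.Involutive a)
    (hb : Function.Involutive b) (ha' : ∀ t, a t ≠ t) (hb' : ∀ t, b t ≠ t) :
    ∃ O : Set T, ∀ t, (a t ∈ O ↔ t ∉ O) ∧ (b t ∈ O ↔ t ∉ O) := by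
  set p : Equiv.Perm T := ha.toPerm with hp
  set q : Equiv.Perm T := hb.toPerm with hq
  have hpa : ∀ t, p t = a t := fun _ => rfl
  have hqb : ∀ t, q t = b t := fun _ => rfl
  have hpp : p * p = 1 := by ext t; exact ha t
  have hqq : q * q = 1 := by ext t; exact hb t
  have hpi : p⁻¹ = p := inv_eq_of_mul_eq_one_left hpp
  have hqi : q⁻¹ = q := inv_eq_of_mul_eq_one_left hqq
  set s := p * q with hs
  have hps : ∀ k : ℤ, p * s ^ k = s ^ (-k) * p := by
    intro k
    have h : p * s * p⁻¹ = s⁻¹ := by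
      rw [hs, mul_inv_rev, hpi, hqi, ← mul_assoc, hpp, one_mul]
    rw [zpow_neg, ← inv_zpow, ← h, conj_zpow, inv_mul_cancel_right]
  have hqs : ∀ k : ℤ, q * s ^ k = s ^ (-k) * q := by
    intro k
    have h : q * s * q⁻¹ = s⁻¹ := by
      rw [hs, mul_inv_rev, hpi, hqi, mul_assoc, mul_assoc, hqq, mul_one]
    rw [zpow_neg, ← inv_zpow, ← h, conj_zpow, inv_mul_cancel_right]
  -- If `a t = s ^ n t`, then halving `n` produces a fixed point: of `a` for even `n`, of `b` for
  -- odd `n`.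
  have hne : ∀ t, ¬ s.SameCycle t (a t) := by
    rintro t ⟨n, hn⟩
    rcases Int.even_or_odd' n with ⟨k, rfl | rfl⟩
    · apply ha' ((s ^ k) t)
      rw [← hpa, ← Equiv.Perm.mul_apply, hps, Equiv.Perm.mul_apply, hpa, ← hn,
        ← Equiv.Perm.mul_apply, ← zpow_add]
      congr 2
      ring
    · apply hb' ((s ^ k) t)
      have h1 : p (q ((s ^ (2 * k)) t)) = p t := by
        rw [hpa t, ← hn, add_comm, zpow_add, zpow_one, hs]; rfl
      have h2 := p.injective h1
      rw [two_mul, zpow_add, Equiv.Perm.mul_apply, ← Equiv.Perm.mul_apply q, hqs,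
        Equiv.Perm.mul_apply, zpow_neg, Equiv.Perm.inv_eq_iff_eq] at h2
      exact h2
  have hmap : ∀ {x y}, s.SameCycle x y → s.SameCycle (a x) (a y) := by
    rintro x y ⟨k, rfl⟩
    refine ⟨-k, ?_⟩
    rw [← hpa, ← hpa, ← Equiv.Perm.mul_apply, ← Equiv.Perm.mul_apply, hps]
  have hba : ∀ t, s.SameCycle (b t) (a t) := by
    intro t
    refine ⟨1, ?_⟩
    rw [zpow_one, hs, Equiv.Perm.mul_apply, hqb, hb t, hpa]
  -- The classes are the orbits of the dihedral group generated by `a` and `b`. Each splits into two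
  -- `s`-cycles exchanged by both involutions; the colour class is the cycle of a chosen
  -- representative.
  let S : Setoid T :=
    { r := fun x y => s.SameCycle x y ∨ s.SameCycle (a x) y
      iseqv :=
        { refl := fun x => Or.inl (Equiv.Perm.SameCycle.refl _ _)
          symm := by
            rintro x y (h | h)
            · exact Or.inl h.symm
            · refine Or.inr ?_
              have := hmap h
              rw [ha x] at this
              exact this.symm
          trans := by
            rintro x y z (h | h) (h' | h')
            · exact Or.inl (h.trans h')
            · exact Or.inr ((hmap h).trans h')
            · exact Or.inr (h.trans h')
            · have := hmap h
              rw [ha x] at this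
              exact Or.inl (this.trans h') } }
  let r : T → T := fun t => (Quotient.mk S t).out
  have hr : ∀ t, s.SameCycle t (r t) ∨ s.SameCycle (a t) (r t) := fun t =>
    S.symm (Quotient.mk_out (s := S) t)
  have hra : ∀ t, r (a t) = r t := fun t => by
    have : Quotient.mk S (a t) = Quotient.mk S t :=
      Quotient.sound (Or.inr (by rw [ha t]))
    simp only [r, this]
  have hrb : ∀ t, r (b t) = r (a t) := fun t => by
    have : Quotient.mk S (b t) = Quotient.mk S (a t) := Quotient.sound (Or.inl (hba t))
    simp only [r, this]
  have key : ∀ t, s.SameCycle (a t) (r t) ↔ ¬ s.SameCycle t (r t) := fun t =>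
    ⟨fun h h' => hne t (h'.trans h.symm), fun h => (hr t).resolve_left h⟩
  refine ⟨{t | s.SameCycle t (r t)}, fun t => ⟨?_, ?_⟩⟩
  · simp only [Set.mem_ofPred_eq, hra]
    exact key t
  · simp only [Set.mem_ofPred_eq, hrb, hra]
    rw [← key t]
    exact ⟨fun h => (hba t).symm.trans h, fun h => (hba t).trans h⟩

lemma exists_involutive_of_even_card {F : Type*} [Finite F] (h : Even (Nat.card F)) :
    ∃ m : F → F, Function.Involutive m ∧ ∀ x, m x ≠ x := by
  obtain ⟨n, hn⟩ := h
  have e : F ≃ Fin n × Bool :=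
    (Finite.equivFinOfCardEq (n := n * 2) (by rw [hn, mul_two])).trans
      (Finite.equivFinOfCardEq (by simp)).symm
  refine ⟨fun x => e.symm ((e x).1, !(e x).2), fun x => by simp, fun x hx => ?_⟩
  rw [Equiv.symm_apply_eq] at hx
  simpa using congrArg Prod.snd hx

/-- Provides the transitions of a closed-trail decomposition: at each vertex the half-edges of an
even subgraph are paired. -/
lemma exists_involutive_of_even_fibers {T α : Type*} [Finite T] (vert : T → α)
    (h : ∀ v, Even (Nat.card {t // vert t = v})) :
    ∃ m : T → T, Function.Involutive m ∧ ∀ t, m t ≠ t ∧ vert (m t) = vert t := by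
  choose m hm hm' using fun v => exists_involutive_of_even_card (h v)
  have hval : ∀ v t (ht : vert t = v), (m (vert t) ⟨t, rfl⟩).1 = (m v ⟨t, ht⟩).1 := by
    rintro _ t rfl; rfl
  refine ⟨fun t => (m (vert t) ⟨t, rfl⟩).1, fun t => ?_, fun t => ⟨fun ht => ?_, ?_⟩⟩
  · simp only
    rw [hval (vert t) _ (m (vert t) ⟨t, rfl⟩).2]
    simp [hm (vert t) _]
  · exact hm' (vert t) ⟨t, rfl⟩ (Subtype.ext ht)
  · exact (m (vert t) ⟨t, rfl⟩).2

/-! ### Arranging the half-edges in a single cycle. -/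

/-- Multiplying by a transposition of two points in different cycles merges these cycles. -/
lemma Equiv.Perm.SameCycle.mul_swap {D : Type*} [DecidableEq D] [Finite D] {ρ : Equiv.Perm D}
    {a b : D} (hab : ¬ ρ.SameCycle a b) {x : D} (hx : ρ.SameCycle a x) :
    (ρ * Equiv.swap a b).SameCycle b x := by
  set ρ' := ρ * Equiv.swap a b with hρ'
  have hb : ρ' b = ρ a := by simp [hρ']
  have main : ∀ n : ℕ, ρ'.SameCycle b ((ρ ^ (n + 1)) a) := by
    intro n
    induction n with
    | zero => exact ⟨1, by simp [hb]⟩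
    | succ n ih =>
      by_cases h : (ρ ^ (n + 1)) a = a
      · refine ⟨1, ?_⟩
        rw [pow_succ' ρ (n + 1), Equiv.Perm.mul_apply, h, zpow_one, hb]
      · have h' : (ρ ^ (n + 1)) a ≠ b := fun hh => hab ⟨(n + 1 : ℕ), by rw [zpow_natCast, hh]⟩
        refine ih.trans ⟨1, ?_⟩
        rw [zpow_one, hρ', Equiv.Perm.mul_apply, Equiv.swap_apply_of_ne_of_ne h h',
          pow_succ' ρ (n + 1), Equiv.Perm.mul_apply]
  obtain ⟨n, hn, -, rfl⟩ := hx.exists_pow_eq''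
  obtain ⟨k, rfl⟩ := Nat.exists_eq_succ_of_ne_zero hn.ne'
  exact main k

/-- The half-edges of a graph with a spanning connected even subgraph (with set `A` of half-edges)
can be arranged cyclically such that each is followed either by a half-edge at the same vertex or by
the other half of its edge, the latter happening exactly once on each edge of the subgraph. -/
lemma exists_cyclic_arrangement {D α : Type*} [Finite D] {vert : D → α} {flip : D → D}
    (hflip : Function.Involutive flip) (hne : ∀ h, flip h ≠ h) {A : Set D}
    (hA : ∀ h ∈ A, flip h ∈ A) (heven : ∀ v, Even (Nat.card {h // h ∈ A ∧ vert h = v}))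
    (hconn : ∀ S : Set α, (∃ h, vert h ∈ S) → (∀ h ∈ A, vert h ∈ S → vert (flip h) ∈ S) →
      ∀ h, vert h ∈ S) :
    ∃ (ρ : Equiv.Perm D) (X : Set D), X ⊆ A ∧ (∀ h ∈ X, ρ h = flip h) ∧
      (∀ h, h ∉ X → vert (ρ h) = vert h) ∧ (∀ h ∈ A, (flip h ∈ X ↔ h ∉ X)) ∧
      ∀ x y, ρ.SameCycle x y := by
  classical
  have hev' : ∀ v, Even (Nat.card {t : A // vert t = v}) := fun v => by
    have e : {t : A // vert t = v} ≃ {h // h ∈ A ∧ vert h = v} :=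
      Equiv.subtypeSubtypeEquivSubtypeInter (fun h => h ∈ A) (fun h => vert h = v)
    rw [Nat.card_congr e]
    exact heven v
  obtain ⟨m, hm, hm'⟩ := exists_involutive_of_even_fibers (fun t : A => vert t) hev'
  obtain ⟨O, hO⟩ := exists_set_alternating (T := A) (a := fun t => ⟨flip t, hA t t.2⟩) (b := m)
    (fun t => Subtype.ext (hflip t)) hm (fun t ht => hne t (congrArg Subtype.val ht))
    (fun t => (hm' t).1)
  let X : Set D := Subtype.val '' O
  have hXA : X ⊆ A := by rintro _ ⟨t, -, rfl⟩; exact t.2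
  have hXmem : ∀ t : A, (t : D) ∈ X ↔ t ∈ O := fun t =>
    ⟨by rintro ⟨t', h, h'⟩; rwa [← Subtype.ext h'], fun h => ⟨t, h, rfl⟩⟩
  have hX : ∀ h ∈ A, (flip h ∈ X ↔ h ∉ X) := fun h hh => by
    have := (hO ⟨h, hh⟩).1
    rwa [← hXmem, ← hXmem] at this
  let P : Equiv.Perm D → Prop := fun ρ =>
    (∀ h ∈ X, ρ h = flip h) ∧ (∀ h, h ∉ X → vert (ρ h) = vert h)
  -- an initial permutation
  have hex : ∃ ρ, P ρ := by
    -- Follows the closed trails: cross the edge from a half in `X`, take the paired half-edge from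
    -- one in `A \ X`, and fix everything outside `A`.
    let r : D → D := fun h => if h ∈ X then flip h else if hA : h ∈ A then m ⟨h, hA⟩ else h
    have hrX : ∀ h ∈ X, r h = flip h := fun h hh => by simp [r, hh]
    have hrA : ∀ h (hh : h ∈ A), h ∉ X → r h = m ⟨h, hh⟩ := fun h hh hh' => by simp [r, hh, hh']
    have hrN : ∀ h, h ∉ A → r h = h := fun h hh => by
      have : h ∉ X := fun h' => hh (hXA h')
      simp [r, hh, this]
    have hmX : ∀ t : A, (t : D) ∉ X → ((m t : A) : D) ∈ X := fun t ht => by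
      rw [hXmem] at ht ⊢
      exact (hO t).2.2 ht
    have hinj : Function.Injective r := by
      intro x y hxy
      by_cases hx : x ∈ X <;> by_cases hy : y ∈ X
      · rw [hrX x hx, hrX y hy] at hxy
        exact hflip.injective hxy
      · rw [hrX x hx] at hxy
        have h1 : flip x ∉ X := fun h => (hX x (hXA hx)).1 h hx
        by_cases hyA : y ∈ A
        · rw [hrA y hyA hy] at hxy
          exact absurd (hxy ▸ hmX ⟨y, hyA⟩ hy) h1
        · rw [hrN y hyA] at hxy
          exact absurd (hxy ▸ hA x (hXA hx)) hyA
      · rw [hrX y hy] at hxy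
        have h1 : flip y ∉ X := fun h => (hX y (hXA hy)).1 h hy
        by_cases hxA : x ∈ A
        · rw [hrA x hxA hx] at hxy
          exact absurd (hxy ▸ hmX ⟨x, hxA⟩ hx) h1
        · rw [hrN x hxA] at hxy
          exact absurd (hxy ▸ hA y (hXA hy)) hxA
      · by_cases hxA : x ∈ A <;> by_cases hyA : y ∈ A
        · rw [hrA x hxA hx, hrA y hyA hy] at hxy
          exact congrArg Subtype.val (hm.injective (Subtype.ext hxy))
        · rw [hrA x hxA hx, hrN y hyA] at hxy
          exact absurd (hxy ▸ (m ⟨x, hxA⟩).2) hyA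
        · rw [hrN x hxA, hrA y hyA hy] at hxy
          exact absurd (hxy ▸ (m ⟨y, hyA⟩).2) hxA
        · rwa [hrN x hxA, hrN y hyA] at hxy
    refine ⟨Equiv.ofBijective r (Finite.injective_iff_bijective.1 hinj), hrX, fun h hh => ?_⟩
    change vert (r h) = vert h
    by_cases hhA : h ∈ A
    · rw [hrA h hhA hh]
      exact (hm' ⟨h, hhA⟩).2
    · rw [hrN h hhA]
  obtain hD | ⟨⟨h0⟩⟩ := isEmpty_or_nonempty D
  · obtain ⟨ρ, hρ⟩ := hex
    exact ⟨ρ, X, hXA, hρ.1, hρ.2, hX, fun x => hD.elim x⟩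
  -- Among admissible permutations, the cycle of `h0` is taken as large as possible; connectivity
  -- then forces it to be everything.
  obtain ⟨ρ, hρ, hmax⟩ := Set.exists_max_image {ρ | P ρ}
    (fun ρ => {x | ρ.SameCycle h0 x}.ncard) (Set.toFinite _) hex
  refine ⟨ρ, X, hXA, hρ.1, hρ.2, hX, ?_⟩
  -- merging
  have hmerge : ∀ a b, a ∉ X → b ∉ X → vert a = vert b → ρ.SameCycle h0 a → ρ.SameCycle h0 b := by
    intro a b ha hb hab h0a
    by_contra h0b
    have hnab : ¬ ρ.SameCycle a b := fun h => h0b (h0a.trans h)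
    -- As `a` and `b` lie outside `X` and share a vertex, the swap changes no edge crossing and
    -- still stays inside that vertex.
    have hP : P (ρ * Equiv.swap a b) := by
      refine ⟨fun h hh => ?_, fun h hh => ?_⟩
      · rw [Equiv.Perm.mul_apply, Equiv.swap_apply_of_ne_of_ne, hρ.1 h hh]
        · rintro rfl; exact ha hh
        · rintro rfl; exact hb hh
      · rw [Equiv.Perm.mul_apply]
        by_cases h1 : h = a
        · rw [h1, Equiv.swap_apply_left, hρ.2 b hb, hab]
        · by_cases h2 : h = b
          · rw [h2, Equiv.swap_apply_right, hρ.2 a ha, hab]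
          · rw [Equiv.swap_apply_of_ne_of_ne h1 h2, hρ.2 h hh]
    have hcyc : ∀ x, ρ.SameCycle a x → (ρ * Equiv.swap a b).SameCycle b x := fun x hx =>
      hx.mul_swap hnab
    have hlt : {x | ρ.SameCycle h0 x}.ncard < {x | (ρ * Equiv.swap a b).SameCycle h0 x}.ncard := by
      apply Set.ncard_lt_ncard _ (Set.toFinite _)
      refine ⟨fun x hx => (hcyc h0 h0a.symm).symm.trans (hcyc x (h0a.symm.trans hx)), fun h => ?_⟩
      exact h0b (h (hcyc h0 h0a.symm).symm)
    exact absurd (hmax _ hP) (not_le.2 hlt)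
  -- each cycle meeting a vertex contains an element outside `X` at that vertex
  have hpred : ∀ h, ∃ a, a ∉ X ∧ vert a = vert h ∧ ρ.SameCycle a h := by
    intro h
    by_cases hh : h ∈ X
    · obtain ⟨y, rfl⟩ := ρ.surjective h
      have hy : y ∉ X := fun hy => by
        rw [hρ.1 y hy] at hh
        exact (hX y (hXA hy)).1 hh hy
      exact ⟨y, hy, (hρ.2 y hy).symm, ⟨1, by simp⟩⟩
    · exact ⟨h, hh, rfl, Equiv.Perm.SameCycle.refl _ _⟩
  have hfib : ∀ x y, vert x = vert y → ρ.SameCycle h0 x → ρ.SameCycle h0 y := by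
    intro x y hxy hx
    obtain ⟨a, ha, hax, hac⟩ := hpred x
    obtain ⟨b, hb, hby, hbc⟩ := hpred y
    exact (hmerge a b ha hb (by rw [hax, hby, hxy]) (hx.trans hac.symm)).trans hbc
  have hall : ∀ h, vert h ∈ vert '' {x | ρ.SameCycle h0 x} := by
    refine hconn _ ⟨h0, h0, Equiv.Perm.SameCycle.refl _ _, rfl⟩ ?_
    rintro h hh ⟨x, hx, hxh⟩
    have hc : ρ.SameCycle h0 h := hfib x h hxh hx
    refine ⟨flip h, hc.trans ?_, rfl⟩
    by_cases h1 : h ∈ X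
    · exact ⟨1, by simp [hρ.1 h h1]⟩
    · have h2 := (hX h hh).2 h1
      exact Equiv.Perm.SameCycle.symm ⟨1, by simp [hρ.1 _ h2, hflip h]⟩
  have h0all : ∀ h, ρ.SameCycle h0 h := by
    intro h
    obtain ⟨x, hx, hxh⟩ := hall h
    exact hfib x h hxh hx
  exact fun x y => (h0all x).symm.trans (h0all y)

/-! ### First returns and summation along cycles. -/

/-- The first-return permutation of a cyclic permutation to the fibres of a map. -/
lemma exists_firstReturn {D α : Type*} [Finite D] (vert : D → α) {ρ : Equiv.Perm D}
    (hρ : ∀ x y, ρ.SameCycle x y) :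
    ∃ N : Equiv.Perm D, (∀ h, vert (N h) = vert h) ∧
      (∀ x y, vert x = vert y → N.SameCycle x y) ∧ ∀ h, vert (ρ h) = vert h → N h = ρ h := by
  classical
  have hret : ∀ h, ∃ n, 0 < n ∧ vert ((ρ ^ n) h) = vert h := fun h => by
    obtain ⟨n, hn, -, h'⟩ := (hρ h h).exists_pow_eq''
    exact ⟨n, hn, by rw [h']⟩
  let n : D → ℕ := fun h => Nat.find (hret h)
  let r : D → D := fun h => (ρ ^ n h) h
  have hn : ∀ h, 0 < n h := fun h => (Nat.find_spec (hret h)).1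
  have hr : ∀ h, vert (r h) = vert h := fun h => (Nat.find_spec (hret h)).2
  have hmin : ∀ h k, 0 < k → vert ((ρ ^ k) h) = vert h → n h ≤ k := fun h k h1 h2 =>
    Nat.find_min' (hret h) ⟨h1, h2⟩
  -- Otherwise the orbit of `y` meets its fibre at `x` after `n y - n x` steps, before its first
  -- return.
  have hle : ∀ x y, r x = r y → n x ≤ n y → x = y := by
    intro x y hxy hxy'
    obtain ⟨k, hk⟩ := Nat.exists_eq_add_of_le hxy'
    have h1 : x = (ρ ^ k) y := by
      apply (ρ ^ n x).injective
      rw [← Equiv.Perm.mul_apply, ← pow_add, ← hk]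
      exact hxy
    rcases Nat.eq_zero_or_pos k with rfl | hk0
    · simpa using h1
    · have h2 := hmin y k hk0 (by rw [← h1, ← hr x, hxy, hr y])
      have := hn x
      omega
  have hinj : Function.Injective r := fun x y hxy => by
    rcases le_total (n x) (n y) with h | h
    · exact hle x y hxy h
    · exact (hle y x hxy.symm h).symm
  let N : Equiv.Perm D := Equiv.ofBijective r (Finite.injective_iff_bijective.1 hinj)
  have hN : ∀ h, N h = r h := fun _ => rfl
  refine ⟨N, hr, fun x y hxy => ?_, fun h hh => ?_⟩
  · have key : ∀ k x, vert ((ρ ^ k) x) = vert x → N.SameCycle x ((ρ ^ k) x) := by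
      intro k
      induction k using Nat.strong_induction_on with
      | _ k ih =>
        intro x hx
        rcases Nat.eq_zero_or_pos k with rfl | hk
        · simpa using Equiv.Perm.SameCycle.refl _ _
        · have h1 := hmin x k hk hx
          have h2 := hn x
          obtain ⟨j, rfl⟩ := Nat.exists_eq_add_of_le' h1
          have h3 : (ρ ^ (j + n x)) x = (ρ ^ j) (N x) := by
            rw [pow_add, Equiv.Perm.mul_apply, hN]
          rw [h3] at hx ⊢
          refine Equiv.Perm.SameCycle.trans ⟨1, by simp⟩ (ih j (by omega) (N x) ?_)
          rw [hx]
          exact (hr x).symm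
    obtain ⟨k, -, -, rfl⟩ := (hρ x y).exists_pow_eq''
    exact key k x hxy.symm
  · have h1 : n h = 1 := le_antisymm (hmin h 1 one_pos (by simpa using hh)) (hn h)
    rw [hN]
    simp only [r, h1, pow_one]

/-- A function with vanishing sums over the fibres is, up to a positive factor, the coboundary of
a nowhere-vanishing function along any permutation acting transitively on the fibres. -/
lemma exists_coboundary {D α : Type*} [Fintype D] [DecidableEq α] (vert : D → α)
    (N : Equiv.Perm D) (hN : ∀ h, vert (N h) = vert h)
    (hN' : ∀ x y, vert x = vert y → N.SameCycle x y) (c : D → ℤ)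
    (hc : ∀ h, ∑ x with vert x = vert h, c x = 0) :
    ∃ (n : ℕ) (g : D → ℤ), 0 < n ∧ (∀ h, g h ≠ 0) ∧ ∀ h, g (N h) - g h = n * c h := by
  set n := orderOf N with hn
  have hpow : ∀ i h, vert ((N ^ i) h) = vert h := by
    intro i h
    induction i with
    | zero => simp
    | succ i ih => rw [pow_succ', Equiv.Perm.mul_apply, hN, ih]
  let T : D → ℤ := fun h => ∑ i ∈ Finset.range n, c ((N ^ i) h)
  have hstep : ∀ i h, (N ^ i) (N h) = (N ^ (i + 1)) h := fun i h => by
    rw [pow_succ, Equiv.Perm.mul_apply]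
  have hTN : ∀ h, T (N h) = T h := by
    intro h
    simp only [T, hstep]
    have := Finset.sum_range_succ' (fun i => c ((N ^ i) h)) n
    rw [Finset.sum_range_succ, pow_orderOf_eq_one] at this
    simp only [pow_zero] at this
    linarith
  have hTcyc : ∀ x y, vert x = vert y → T x = T y := by
    intro x y hxy
    obtain ⟨k, -, -, rfl⟩ := (hN' x y hxy).exists_pow_eq''
    clear hxy
    induction k with
    | zero => simp
    | succ k ih => rw [pow_succ', Equiv.Perm.mul_apply, hTN, ← ih]
  -- `T` is constant on each fibre, and its sum there is `n` times that of `c`, which vanishes.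
  have hT : ∀ h, T h = 0 := by
    intro h
    have h1 : ∑ x with vert x = vert h, T x = 0 := by
      simp only [T]
      rw [Finset.sum_comm]
      refine Finset.sum_eq_zero fun i _ => ?_
      rw [← hc h]
      refine Finset.sum_equiv (N ^ i) (fun x => ?_) (fun _ _ => rfl)
      simp [hpow]
    rw [Finset.sum_congr rfl (g := fun _ => T h)
      (fun x hx => hTcyc x h (by simpa using hx)), Finset.sum_const, nsmul_eq_mul] at h1
    refine (mul_eq_zero.1 h1).resolve_left ?_
    exact Nat.cast_ne_zero.2 (Finset.card_pos.2 ⟨h, by simp⟩).ne'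
  -- By summation by parts the weights `i` give coboundary `n * c - T ∘ N`. This avoids choosing a
  -- starting point in each cycle, at the cost of the factor `n`.
  let g₀ : D → ℤ := fun h => ∑ i ∈ Finset.range n, (i : ℤ) * c ((N ^ i) h)
  have hg₀ : ∀ h, g₀ (N h) - g₀ h = n * c h := by
    intro h
    have h1 := Finset.sum_range_succ' (fun i => (i : ℤ) * c ((N ^ i) h)) n
    rw [Finset.sum_range_succ, pow_orderOf_eq_one] at h1
    simp only [Nat.cast_add, Nat.cast_one, Nat.cast_zero, zero_mul, add_zero, add_mul, one_mul,
      Finset.sum_add_distrib, ← hstep] at h1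
    have h2 := hT (N h)
    simp only [T] at h2
    simp only [g₀]
    rw [h2] at h1
    simp only [Equiv.Perm.coe_one, id_eq] at h1
    linarith
  -- A constant shift keeps the coboundary and makes every value positive.
  refine ⟨n, fun h => g₀ h + (1 + ∑ x, |g₀ x|), orderOf_pos N, fun h => ?_, fun h => ?_⟩
  · have h1 := Finset.single_le_sum (f := fun x => |g₀ x|) (fun x _ => abs_nonneg _)
      (Finset.mem_univ h)
    have h2 := neg_abs_le (g₀ h)
    simp only at h1 ⊢
    intro h3
    linarith
  · rw [← hg₀ h]
    ring

/-! ### Half-edges and the cubic expansion. -/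

namespace Graph

variable {α β : Type*} {G H : Graph α β}

/-- A half-edge of a loopless graph, as an incident edge-vertex pair. -/
abbrev HalfEdge (G : Graph α β) : Type _ := {p : β × α // G.Inc p.1 p.2}

namespace HalfEdge

/-- The edge of a half-edge. -/
def edge (h : G.HalfEdge) : E(G) := ⟨h.1.1, h.2.edge_mem⟩

/-- The vertex of a half-edge. -/
def vert (h : G.HalfEdge) : α := h.1.2

/-- The other half of the edge. -/
noncomputable def flip (h : G.HalfEdge) : G.HalfEdge := ⟨(h.1.1, h.2.other), h.2.inc_other⟩

lemma ext {x y : G.HalfEdge} (he : x.edge = y.edge) (hv : x.vert = y.vert) : x = y :=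
  Subtype.ext (Prod.ext (congrArg Subtype.val he) hv)

lemma inc (x : G.HalfEdge) : G.Inc x.edge x.vert := x.2

lemma isLink_flip (x : G.HalfEdge) : G.IsLink x.edge x.vert x.flip.vert := x.2.isLink_other

@[simp]
lemma edge_flip (x : G.HalfEdge) : x.flip.edge = x.edge := rfl

lemma flip_involutive : Function.Involutive (flip (G := G)) := fun x => by
  refine ext rfl ?_
  have h1 := x.flip.isLink_flip
  rw [edge_flip] at h1
  exact h1.right_unique x.isLink_flip.symm

@[simp]
lemma flip_flip (x : G.HalfEdge) : x.flip.flip = x := flip_involutive x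

lemma vert_flip_ne (hG : G.Loopless) (x : G.HalfEdge) : x.flip.vert ≠ x.vert :=
  x.isLink_flip.ne.symm

lemma flip_ne (hG : G.Loopless) (x : G.HalfEdge) : x.flip ≠ x := fun h =>
  vert_flip_ne hG x (congrArg vert h)

lemma eq_or_eq_flip {x y : G.HalfEdge} (h : x.edge = y.edge) : y = x ∨ y = x.flip := by
  have hy := y.inc
  rw [← h] at hy
  rcases hy.eq_or_eq_of_isLink x.isLink_flip with h' | h'
  · exact Or.inl (ext h.symm h')
  · exact Or.inr (ext h.symm h')

lemma exists_edge_eq (e : E(G)) : ∃ x : G.HalfEdge, x.edge = e := by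
  obtain ⟨x, y, h⟩ := G.exists_isLink_of_mem_edgeSet e.2
  exact ⟨⟨(e, x), y, h⟩, rfl⟩

lemma finite (hV : V(G).Finite) (hE : E(G).Finite) : Finite G.HalfEdge :=
  ((hE.prod hV).subset fun p (hp : G.Inc p.1 p.2) => ⟨hp.edge_mem, hp.vertex_mem⟩).to_subtype

end HalfEdge

open HalfEdge

/-- The graph obtained by replacing each vertex by circuits on its half-edges, following the
permutation `N`. -/
def expand (G : Graph α β) (N : Equiv.Perm G.HalfEdge) : Graph G.HalfEdge (E(G) ⊕ G.HalfEdge) where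
  vertexSet := Set.univ
  edgeSet := Set.univ
  IsLink := Sum.elim (fun e x y => x.edge = e ∧ y = x.flip)
    (fun d x y => (x = d ∧ y = N d) ∨ (y = d ∧ x = N d))
  isLink_symm := by
    rintro (e | d) -
    · refine ⟨?_⟩
      rintro x y ⟨rfl, rfl⟩
      simp
    · exact ⟨fun x y h => h.symm⟩
  eq_or_eq_of_isLink_of_isLink := by
    rintro (e | d) x y v w h h'
    · obtain ⟨rfl, rfl⟩ := h
      obtain ⟨h, rfl⟩ := h'
      rcases eq_or_eq_flip h.symm with rfl | rfl <;> simp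
    · rcases h with ⟨rfl, rfl⟩ | ⟨rfl, rfl⟩ <;> rcases h' with ⟨rfl, rfl⟩ | ⟨rfl, rfl⟩ <;> simp
  edge_mem_iff_exists_isLink := by
    rintro (e | d)
    · obtain ⟨x, hx⟩ := exists_edge_eq e
      simp only [Set.mem_univ, true_iff]
      exact ⟨x, _, hx, rfl⟩
    · simp only [Set.mem_univ, true_iff]
      exact ⟨d, N d, Or.inl ⟨rfl, rfl⟩⟩
  left_mem_of_isLink := fun _ _ _ _ => Set.mem_univ _

section Expand

variable {N : Equiv.Perm G.HalfEdge}

lemma expand_isLink_inr {d x y : G.HalfEdge} :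
    (G.expand N).IsLink (.inr d) x y ↔ (x = d ∧ y = N d) ∨ (y = d ∧ x = N d) := Iff.rfl

lemma expand_inc_inl {e : E(G)} {x : G.HalfEdge} :
    (G.expand N).Inc (.inl e) x ↔ x.edge = e :=
  ⟨fun ⟨_, h, _⟩ => h, fun h => ⟨_, h, rfl⟩⟩

lemma expand_inc_inr {d x : G.HalfEdge} :
    (G.expand N).Inc (.inr d) x ↔ x = d ∨ x = N d := by
  simp only [Inc, expand_isLink_inr]
  constructor
  · rintro ⟨y, ⟨h, -⟩ | ⟨-, h⟩⟩
    exacts [Or.inl h, Or.inr h]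
  · rintro (h | h)
    exacts [⟨_, Or.inl ⟨h, rfl⟩⟩, ⟨_, Or.inr ⟨rfl, h⟩⟩]

lemma incidenceSet_expand (x : G.HalfEdge) :
    (G.expand N).incidenceSet x = {.inl x.edge, .inr x, .inr (N.symm x)} := by
  ext (e | d)
  · simp [expand_inc_inl, eq_comm]
  · simp [expand_inc_inr, Equiv.eq_symm_apply, eq_comm]

lemma loopless_expand (hG : G.Loopless) (hN : ∀ x, N x ≠ x) : (G.expand N).Loopless := by
  refine ⟨?_⟩
  rintro (e | d) x h
  · exact flip_ne hG x h.2.symm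
  · rcases h with ⟨rfl, h⟩ | ⟨rfl, h⟩ <;> exact hN _ h.symm

lemma degree_eq_ncard_incidenceSet (hG : G.Loopless) (v : α) :
    G.degree v = (G.incidenceSet v).ncard := by
  have : G.loopSet v = ∅ := Set.eq_empty_of_forall_notMem fun e he => hG.not_isLoopAt e v he
  simp [degree, this]

lemma isCubic_expand (hG : G.Loopless) (hN : ∀ x, N x ≠ x) : (G.expand N).IsCubic := by
  intro x _
  rw [degree_eq_ncard_incidenceSet (loopless_expand hG hN), incidenceSet_expand]
  have h : x ≠ N.symm x := fun h => hN x (by rw [Equiv.eq_symm_apply] at h; exact h)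
  rw [Set.ncard_insert_of_notMem (by simp), Set.ncard_pair (by simpa using h)]

/-- The orbit of `ρ` visits every half-edge once. A step from `X` uses an old edge, any other step a
circuit edge of `N`; `hX'` prevents an old edge from being used in both directions. -/
lemma isHamiltonian_expand (hG : G.Loopless) (hN : ∀ x, N x ≠ x) [Nonempty G.HalfEdge]
    [Finite G.HalfEdge]
    {ρ : Equiv.Perm G.HalfEdge} {X : Set G.HalfEdge} (hX : ∀ h ∈ X, ρ h = h.flip)
    (hX' : ∀ h ∈ X, h.flip ∉ X) (hρN : ∀ h, h ∉ X → N h = ρ h) (hρ : ∀ x y, ρ.SameCycle x y) :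
    (G.expand N).IsHamiltonian := by
  classical
  let l : G.HalfEdge → E(G) ⊕ G.HalfEdge := fun h => if h ∈ X then .inl h.edge else .inr h
  have hl : ∀ h, (G.expand N).IsLink (l h) h (ρ h) := fun h => by
    by_cases hh : h ∈ X
    · simp only [l, hh, if_true]
      exact ⟨rfl, hX h hh⟩
    · simp only [l, hh, if_false]
      exact Or.inl ⟨rfl, (hρN h hh).symm⟩
  have hinj : Function.Injective l := by
    intro x y hxy
    by_cases hx : x ∈ X <;> by_cases hy : y ∈ X <;>
      simp only [l, hx, hy, if_true, if_false, reduceCtorEq, Sum.inl.injEq, Sum.inr.injEq] at hxy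
    · rcases eq_or_eq_flip hxy with rfl | rfl
      · rfl
      · exact absurd hy (hX' x hx)
    · exact hxy
  have hρne : ∀ x, ρ x ≠ x := fun x => by
    by_cases hx : x ∈ X
    · rw [hX x hx]
      exact flip_ne hG x
    · rw [← hρN x hx]
      exact hN x
  have hll := loopless_expand hG hN
  refine ⟨(G.expand N).restrict (Set.range l), ⟨restrict_le, rfl⟩, ⟨Set.univ_nonempty, ?_⟩, ?_⟩
  · intro x _ y hy
    obtain ⟨n, -, -, rfl⟩ := (hρ x y).exists_pow_eq''
    clear hy
    induction n with
    | zero => exact .refl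
    | succ n ih =>
      refine ih.tail ⟨l ((ρ ^ n) x), ⟨_, rfl⟩, ?_⟩
      rw [pow_succ', Equiv.Perm.mul_apply]
      exact hl _
  · intro x _
    rw [degree_eq_ncard_incidenceSet
      ⟨fun e x h => hll.not_isLoopAt e x (restrict_isLoopAt.1 h).1⟩]
    have : ((G.expand N).restrict (Set.range l)).incidenceSet x = {l x, l (ρ.symm x)} := by
      ext e
      simp only [mem_incidenceSet, restrict_inc, Set.mem_insert_iff, Set.mem_singleton_iff]
      constructor
      · rintro ⟨h, y, rfl⟩
        rcases h.eq_or_eq_of_isLink (hl y) with rfl | rfl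
        · exact Or.inl rfl
        · right; simp
      · rintro (rfl | rfl)
        · exact ⟨(hl x).inc_left, _, rfl⟩
        · refine ⟨?_, _, rfl⟩
          have := (hl (ρ.symm x)).inc_right
          rwa [Equiv.apply_symm_apply] at this
    rw [this, Set.ncard_pair]
    intro h
    exact hρne x (by have := hinj h; rw [Equiv.eq_symm_apply] at this; exact this)

end Expand

/-- The half-edges of a finite loopless graph with an edge and a spanning Eulerian subgraph can be
arranged cyclically along an Euler tour of the subgraph. -/
lemma IsSupereulerian.exists_cyclic_arrangement (hV : V(G).Finite) (hE : E(G).Finite)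
    (hG : G.Loopless) (hs : G.IsSupereulerian) :
    ∃ (ρ : Equiv.Perm G.HalfEdge) (X : Set G.HalfEdge), (∀ h ∈ X, ρ h = h.flip) ∧
      (∀ h, h ∉ X → (ρ h).vert = h.vert) ∧ (∀ h ∈ X, h.flip ∉ X) ∧ ∀ x y, ρ.SameCycle x y := by
  obtain ⟨H, hHG, ⟨-, hconn⟩, heven⟩ := hs
  have hVH := hHG.vertexSet_eq
  have hH : H.Loopless := ⟨fun e x h => hG.not_isLoopAt e x (h.mono hHG.le)⟩
  have := HalfEdge.finite hV hE
  have hfib : ∀ v, Even (Nat.card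
      {h : G.HalfEdge // h ∈ {h : G.HalfEdge | (h.edge : β) ∈ E(H)} ∧ vert h = v}) := by
    intro v
    have hcard : Nat.card
        {h : G.HalfEdge // h ∈ {h : G.HalfEdge | (h.edge : β) ∈ E(H)} ∧ vert h = v} =
        (H.incidenceSet v).ncard := by
      refine Nat.card_congr ⟨fun h => ⟨h.1.edge, ?_⟩,
        fun e => ⟨⟨(e, v), Inc.mono hHG.le e.2⟩, Inc.edge_mem e.2, rfl⟩, ?_, ?_⟩
      · obtain ⟨h, hh, rfl⟩ := h
        exact (hHG.le.inc_congr hh).2 h.2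
      · rintro ⟨h, hh, rfl⟩
        rfl
      · rintro e
        rfl
    rw [hcard]
    by_cases hv : v ∈ V(H)
    · rw [← degree_eq_ncard_incidenceSet hH]
      exact heven v hv
    · have : H.incidenceSet v = ∅ := Set.eq_empty_of_forall_notMem fun e he => hv he.vertex_mem
      simp [this]
  have hclosed : ∀ S : Set α, (∃ h : G.HalfEdge, h.vert ∈ S) →
      (∀ h ∈ {h : G.HalfEdge | (h.edge : β) ∈ E(H)}, h.vert ∈ S → h.flip.vert ∈ S) →
      ∀ h : G.HalfEdge, h.vert ∈ S := by
    rintro S ⟨h, hh⟩ hS h'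
    have hreach := hconn h.vert (hVH ▸ h.2.vertex_mem) h'.vert (hVH ▸ h'.2.vertex_mem)
    generalize h'.vert = w at hreach ⊢
    induction hreach with
    | refl => exact hh
    | @tail b c _ hbc ih =>
      obtain ⟨e, he⟩ := hbc
      have hi : G.Inc e b := ⟨c, he.mono hHG.le⟩
      have := hS ⟨(e, b), hi⟩ he.edge_mem ih
      have hc : (HalfEdge.flip ⟨(e, b), hi⟩ : G.HalfEdge).vert = c :=
        (HalfEdge.isLink_flip (⟨(e, b), hi⟩ : G.HalfEdge)).right_unique (he.mono hHG.le)
      rwa [hc] at this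
  obtain ⟨ρ, X, hXA, h1, h2, h3, h4⟩ := _root_.exists_cyclic_arrangement (D := G.HalfEdge)
    flip_involutive (flip_ne hG) (fun h hh => hh) hfib hclosed
  exact ⟨ρ, X, h1, h2, fun h hh hh' => (h3 h (hXA hh)).1 hh' hh, h4⟩

end Graph

/-! ### Transferring flows between a signed graph and its expansion. -/

namespace SignedGraph

open Graph Graph.HalfEdge

variable {α β : Type*} {Γ : SignedGraph α β}

lemma finite_halfEdge (Γ : SignedGraph α β) : Finite Γ.graph.HalfEdge :=
  HalfEdge.finite Γ.finite_vertexSet Γ.finite_edgeSet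

lemma boundary_eq_sum [Fintype Γ.graph.HalfEdge] [DecidableEq α] (τ : β → α → ℤˣ) (f : β → ℤ)
    (v : α) : Γ.boundary τ f v =
      ∑ x : Γ.graph.HalfEdge with x.vert = v, ((τ x.edge x.vert : ℤˣ) : ℤ) * f x.edge := by
  rw [boundary, ← finsum_mem_coe_finset]
  symm
  refine finsum_mem_eq_of_bijOn (fun x => (x.edge : β)) ⟨fun x hx => ?_, fun x hx y hy hxy => ?_,
    fun e he => ?_⟩ fun x hx => ?_
  · have hx' : x.vert = v := by simpa using hx
    exact hx' ▸ x.inc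
  · have hx' : x.vert = v := by simpa using hx
    have hy' : y.vert = v := by simpa using hy
    exact HalfEdge.ext (Subtype.ext hxy) (hx'.trans hy'.symm)
  · exact ⟨⟨(e, v), he⟩, Finset.mem_coe.2 (Finset.mem_filter.2 ⟨Finset.mem_univ _, rfl⟩), rfl⟩
  · have hx' : x.vert = v := by simpa using hx
    rw [hx']

/-- The signed expansion, in which the new edges are positive. -/
def expand (Γ : SignedGraph α β) {N : Equiv.Perm Γ.graph.HalfEdge} (hN : ∀ x, N x ≠ x) :
    SignedGraph Γ.graph.HalfEdge (E(Γ.graph) ⊕ Γ.graph.HalfEdge) where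
  graph := Γ.graph.expand N
  finite_vertexSet := have := Γ.finite_halfEdge; Set.toFinite _
  finite_edgeSet :=
    have := Γ.finite_halfEdge
    have := Γ.finite_edgeSet.to_subtype
    Set.toFinite _
  loopless := loopless_expand Γ.loopless hN
  sign := Sum.elim (fun e => Γ.sign e) (fun _ => 1)

section Expand

variable {N : Equiv.Perm Γ.graph.HalfEdge} {hN : ∀ x, N x ≠ x}

lemma boundary_expand (τ : E(Γ.graph) ⊕ Γ.graph.HalfEdge → Γ.graph.HalfEdge → ℤˣ)
    (f : E(Γ.graph) ⊕ Γ.graph.HalfEdge → ℤ) (x : Γ.graph.HalfEdge) :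
    (Γ.expand hN).boundary τ f x = ((τ (.inl x.edge) x : ℤˣ) : ℤ) * f (.inl x.edge) +
      (((τ (.inr x) x : ℤˣ) : ℤ) * f (.inr x) +
        ((τ (.inr (N.symm x)) x : ℤˣ) : ℤ) * f (.inr (N.symm x))) := by
  have h : x ≠ N.symm x := fun h => hN x (by rw [Equiv.eq_symm_apply] at h; exact h)
  have hi : (Γ.expand hN).graph.incidenceSet x = _ := incidenceSet_expand x
  rw [boundary, hi, finsum_mem_insert _ (by simp) (Set.toFinite _),
    finsum_mem_pair (by simpa using h)]

/-- A nowhere-zero flow of the expansion induces one of the original graph by contraction. -/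
lemma AdmitsNowhereZeroFlow.of_expand (hvert : ∀ x, (N x).vert = x.vert) {k : ℕ}
    (h : (Γ.expand hN).AdmitsNowhereZeroFlow k) : Γ.AdmitsNowhereZeroFlow k := by
  classical
  have := Γ.finite_halfEdge
  have := Fintype.ofFinite Γ.graph.HalfEdge
  obtain ⟨τ, f, hf, hf0⟩ := h
  -- The default values off the half-edges and edges never enter a boundary.
  let τ' : β → α → ℤˣ := fun e v =>
    if h : Γ.graph.Inc e v then τ (.inl ⟨e, h.edge_mem⟩) ⟨(e, v), h⟩ else 1
  let f' : β → ℤ := fun e => if h : e ∈ E(Γ.graph) then f (.inl ⟨e, h⟩) else 0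
  have hτ' : ∀ x : Γ.graph.HalfEdge, τ' x.edge x.vert = τ (.inl x.edge) x := fun x =>
    dif_pos x.inc
  have hf' : ∀ e : E(Γ.graph), f' e = f (.inl e) := fun e => dif_pos e.2
  refine ⟨τ', f', ⟨fun e x y hxy => ?_, fun v _ => ?_, fun e he => ?_⟩, fun e he => ?_⟩
  · let p : Γ.graph.HalfEdge := ⟨(e, x), hxy.inc_left⟩
    let q : Γ.graph.HalfEdge := ⟨(e, y), hxy.inc_right⟩
    have hq : q = p.flip := HalfEdge.ext rfl (hxy.right_unique p.isLink_flip)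
    have h1 : τ' e x = τ (.inl p.edge) p := hτ' p
    have h2 : τ' e y = τ (.inl p.edge) q := hτ' q
    rw [h1, h2]
    exact hf.isOrientation (.inl p.edge) p q ⟨rfl, hq⟩
  · rw [boundary_eq_sum]
    simp only [hτ', hf']
    have hτN : ∀ x, ((τ (.inr x) (N x) : ℤˣ) : ℤ) = -(τ (.inr x) x : ℤˣ) := fun x => by
      have h := hf.isOrientation (.inr x) x (N x) (Or.inl ⟨rfl, rfl⟩)
      have hs : (Γ.expand hN).sign (.inr x) = 1 := rfl
      rw [hs] at h
      rcases Int.units_eq_one_or (τ (.inr x) x) with h1 | h1 <;> rw [h1] at h ⊢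
      · rw [one_mul] at h
        simp [h]
      · rw [neg_one_mul, neg_inj] at h
        simp [h]
    have hsum : ∑ x : Γ.graph.HalfEdge with x.vert = v, (Γ.expand hN).boundary τ f x = 0 :=
      Finset.sum_eq_zero fun x _ => hf.boundary_eq_zero x (Set.mem_univ _)
    simp only [boundary_expand, Finset.sum_add_distrib] at hsum
    -- Both ends of a circuit edge lie over the same vertex and, the edge being positive, contribute
    -- with opposite signs.
    have hre : ∑ x : Γ.graph.HalfEdge with x.vert = v,
        ((τ (.inr (N.symm x)) x : ℤˣ) : ℤ) * f (.inr (N.symm x)) =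
        ∑ x : Γ.graph.HalfEdge with x.vert = v, -(((τ (.inr x) x : ℤˣ) : ℤ) * f (.inr x)) := by
      symm
      refine Finset.sum_equiv N (fun x => by simp [hvert]) (fun x _ => ?_)
      rw [Equiv.symm_apply_apply, hτN, neg_mul]
    rw [hre, Finset.sum_neg_distrib, add_neg_cancel, add_zero] at hsum
    exact hsum
  · rw [hf' ⟨e, he⟩]
    exact hf.abs_lt (.inl ⟨e, he⟩) (Set.mem_univ _)
  · rw [hf' ⟨e, he⟩]
    exact hf0 (.inl ⟨e, he⟩) (Set.mem_univ _)

lemma FlowAdmissible.expand (hvert : ∀ x, (N x).vert = x.vert)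
    (hcyc : ∀ x y : Γ.graph.HalfEdge, x.vert = y.vert → N.SameCycle x y)
    (h : Γ.FlowAdmissible) : (Γ.expand hN).FlowAdmissible := by
  classical
  have := Γ.finite_halfEdge
  have := Fintype.ofFinite Γ.graph.HalfEdge
  have := Γ.finite_edgeSet.to_subtype
  have := Fintype.ofFinite E(Γ.graph)
  obtain ⟨k, τ, f, hf, hf0⟩ := h
  let b : Γ.graph.HalfEdge → ℤ := fun x => ((τ x.edge x.vert : ℤˣ) : ℤ) * f x.edge
  have hb : ∀ h : Γ.graph.HalfEdge, ∑ x : Γ.graph.HalfEdge with x.vert = h.vert, b x = 0 :=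
    fun h => by
      have h' := hf.boundary_eq_zero _ h.inc.vertex_mem
      rwa [boundary_eq_sum] at h'
  -- Conservation at `N h` involves the circuit edges `h` and `N h` and the old half-edge `N h`,
  -- hence the shifted function `b ∘ N`.
  obtain ⟨n, g, hn, hg0, hg⟩ := exists_coboundary vert N hvert hcyc (fun x => b (N x))
    (fun h => by
      rw [← hb h]
      exact Finset.sum_equiv N (fun x => by simp [hvert]) (fun x _ => rfl))
  let f' : E(Γ.graph) ⊕ Γ.graph.HalfEdge → ℤ := Sum.elim (fun e => n * f e) g
  -- The circuit edge `d` is directed from `N d` to `d`.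
  let τ' : E(Γ.graph) ⊕ Γ.graph.HalfEdge → Γ.graph.HalfEdge → ℤˣ :=
    Sum.elim (fun e x => τ e x.vert) (fun d x => if x = d then -1 else 1)
  have hle : ∀ e, |f' e| < ((∑ e, (f' e).natAbs + 1 : ℕ) : ℤ) := fun e => by
    have := Finset.single_le_sum (f := fun e => (f' e).natAbs) (fun _ _ => Nat.zero_le _)
      (Finset.mem_univ e)
    rw [Int.abs_eq_natAbs]
    exact_mod_cast Nat.lt_succ_of_le this
  refine ⟨_, τ', f', ⟨?_, fun x _ => ?_, fun e _ => hle e⟩, ?_⟩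
  · rintro (e | d) x y h
    · obtain ⟨rfl, rfl⟩ := h
      exact hf.isOrientation _ _ _ x.isLink_flip
    · rcases h with ⟨rfl, rfl⟩ | ⟨rfl, rfl⟩ <;> simp [τ', hN, SignedGraph.expand]
  · have h := hg (N.symm x)
    have hne : x ≠ N.symm x := fun h => hN x (by rw [Equiv.eq_symm_apply] at h; exact h)
    simp only [Equiv.apply_symm_apply, b] at h
    rw [boundary_expand]
    simp only [τ', f', Sum.elim_inl, Sum.elim_inr, if_true, if_neg hne]
    push_cast
    linarith
  · rintro (e | d) _
    · exact mul_ne_zero (Nat.cast_ne_zero.2 hn.ne') (hf0 e e.2)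
    · exact hg0 d

end Expand

end SignedGraph

/-! ### The equivalence. -/

open SignedGraph Graph Graph.HalfEdge in
theorem theorem3p4 (k : ℕ) (hk : 0 < k) :
    List.TFAE [
      ∀ (α β : Type u) (Γ : SignedGraph α β),
        Γ.FlowAdmissible → Γ.graph.IsSupereulerian → Γ.AdmitsNowhereZeroFlow k,
      ∀ (α β : Type u) (Γ : SignedGraph α β),
        Γ.FlowAdmissible → Γ.graph.IsHamiltonian → Γ.AdmitsNowhereZeroFlow k,
      ∀ (α β : Type u) (Γ : SignedGraph α β),
        Γ.FlowAdmissible → Γ.graph.IsHamiltonian → Γ.graph.IsCubic →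
          Γ.AdmitsNowhereZeroFlow k] := by
  tfae_have 1 → 2 := fun h α β Γ hΓ ⟨H, hH, hc, hr⟩ =>
    h α β Γ hΓ ⟨H, hH, hc, fun v hv => by rw [hr v hv]; exact even_two⟩
  tfae_have 2 → 3 := fun h α β Γ hΓ hH _ => h α β Γ hΓ hH
  tfae_have 3 → 1 := by
    intro h α β Γ hΓ hs
    have := Γ.finite_halfEdge
    -- Without edges the expansion has no vertices, so it is not Hamiltonian; here the given flow
    -- already works for `k`.
    obtain hE | hne := isEmpty_or_nonempty Γ.graph.HalfEdge
    · have hE' : ∀ e, e ∉ E(Γ.graph) := fun e he => hE.elim (exists_edge_eq ⟨e, he⟩).choose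
      obtain ⟨_, τ, f, hf, hf0⟩ := hΓ
      exact ⟨τ, f, ⟨hf.1, hf.2, fun e he => absurd he (hE' e)⟩, hf0⟩
    obtain ⟨ρ, X, hX, hX', hXf, hρ⟩ :=
      hs.exists_cyclic_arrangement Γ.finite_vertexSet Γ.finite_edgeSet Γ.loopless
    obtain ⟨N, hvert, hcyc, hρN⟩ := exists_firstReturn vert hρ
    -- A fixed point would be the only half-edge at its vertex. Then `ρ` either fixes it or has to
    -- cross its edge in both directions, and neither is possible.
    have hN : ∀ x, N x ≠ x := by
      intro x hx
      have hfib : ∀ y : Γ.graph.HalfEdge, y.vert = x.vert → y = x := fun y hy => by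
        obtain ⟨n, rfl⟩ := hcyc x y hy.symm
        exact Equiv.Perm.zpow_apply_eq_self_of_apply_eq_self hx n
      obtain ⟨y, hy⟩ := ρ.surjective x
      by_cases hxX : x ∈ X
      · by_cases hyX : y ∈ X
        · exact hXf y hyX (by rwa [← hX y hyX, hy])
        · exact hyX (by rwa [hfib y (by rw [← hX' y hyX, hy])])
      · have hρx : ρ x = x := hfib _ (hX' x hxX)
        obtain ⟨n, hn⟩ := hρ x x.flip
        rw [Equiv.Perm.zpow_apply_eq_self_of_apply_eq_self hρx n] at hn
        exact flip_ne Γ.loopless x hn.symm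
    exact .of_expand (hN := hN) hvert (h _ _ _ (hΓ.expand hvert hcyc)
      (isHamiltonian_expand Γ.loopless hN hX hXf (fun x hx => hρN x (hX' x hx)) hρ)
      (isCubic_expand Γ.loopless hN))
  tfae_finish
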